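/- Let $p$ be a prime number and let $G=\mathbb{Q}_p^2$, regarded as a topological group under addition. Let $\mathcal{B}(G)$ be the set of compact open subgroups of $G$ with the metric $d(V,W)=\log\bigl(|V:V\cap W|\cdot|W:W\cap V|\bigr)$, on which every group of topological automorphisms of $G$ acts by $\varphi.V=\varphi(V)$. A group $\mathcal{H}$ of topological automorphisms of $G$ is called flat if there is $O\in\mathcal{B}(G)$ such that $d(\varphi(O),O)\le d(\varphi(V),V)$ for all $\varphi\in\mathcal{H}$ and all $V\in\mathcal{B}(G)$. Let $\mathcal{H}$ be the group of automorphisms of $G$ generated by the linear maps $$s_1=\begin{pmatrix}0&-1\\1&0\end{pmatrix},\qquad s_2=\begin{pmatrix}0&-p^{-1}\\p&0\end{pmatrix}.$$ Then: (a) the metric space $\mathcal{B}(G)$ is proper (closed balls are compact); (b) $\mathcal{H}$ contains the central subgroup $\{1,-1\}$, and $\mathcal{H}/\{1,-1\}$ is the infinite dihedral group, with the images of $s_1$ and $s_2$ as its canonical generating reflections; (c) every orbit of $\mathcal{H}$ in $\mathcal{B}(G)$, with the restricted metric, is quasi-isometric to $\mathbb{R}$; (d) $\mathcal{H}$ is not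 flat. -/

import Mathlib

noncomputable section

/-- The topological automorphisms of a topological (additive) group form a group under
composition: `(φ * ψ) x = φ (ψ x)`. -/
instance ContinuousAddEquiv.instGroupSelf {G : Type*} [AddGroup G] [TopologicalSpace G] :
    Group (G ≃ₜ+ G) where
  mul φ ψ := ψ.trans φ
  one := ContinuousAddEquiv.refl G
  inv φ := φ.symm
  mul_assoc _ _ _ := rfl
  one_mul _ := rfl
  mul_one _ := rfl
  inv_mul_cancel φ := ContinuousAddEquiv.ext fun x => φ.symm_apply_apply x

/-- `𝓑(G)`: the set of compact, open subgroups of a topological group `G`, written additively. -/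
@[ext]
structure CompactOpenSubgroup (G : Type*) [AddGroup G] [TopologicalSpace G] where
  toAddSubgroup : AddSubgroup G
  isCompact : IsCompact (toAddSubgroup : Set G)
  isOpen : IsOpen (toAddSubgroup : Set G)

namespace CompactOpenSubgroup

section Action

variable {G : Type*} [AddGroup G] [TopologicalSpace G]

/-- The image `φ(V)` of a compact, open subgroup under a topological automorphism. -/
def map (φ : G ≃ₜ+ G) (V : CompactOpenSubgroup G) : CompactOpenSubgroup G where
  toAddSubgroup := V.toAddSubgroup.map (φ : G →+ G)
  isCompact := V.isCompact.image φ.continuous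
  isOpen := φ.toHomeomorph.isOpenMap _ V.isOpen

/-- The natural action of the automorphism group of `G` on `𝓑(G)`. -/
instance : MulAction (G ≃ₜ+ G) (CompactOpenSubgroup G) where
  smul := map
  one_smul V := CompactOpenSubgroup.ext (AddSubgroup.map_id V.toAddSubgroup)
  mul_smul φ ψ V := CompactOpenSubgroup.ext
    (AddSubgroup.map_map V.toAddSubgroup (φ : G →+ G) (ψ : G →+ G)).symm

end Action

section Metric

variable {G : Type*} [AddGroup G] [TopologicalSpace G]

/-- `|V : V ∩ W|`. -/
def idx (V W : CompactOpenSubgroup G) : ℕ :=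
  (V.toAddSubgroup ⊓ W.toAddSubgroup).relIndex V.toAddSubgroup

theorem idx_eq (V W : CompactOpenSubgroup G) :
    V.idx W = W.toAddSubgroup.relIndex V.toAddSubgroup :=
  AddSubgroup.inf_relIndex_left _ _

variable [IsTopologicalAddGroup G]

theorem idx_pos (V W : CompactOpenSubgroup G) : 0 < V.idx W := by
  rw [idx_eq]
  have : CompactSpace V.toAddSubgroup := isCompact_iff_compactSpace.mp V.isCompact
  have := AddSubgroup.quotient_finite_of_isOpen
    (W.toAddSubgroup.addSubgroupOf V.toAddSubgroup)
    (W.isOpen.preimage continuous_subtype_val)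
  exact Nat.pos_of_ne_zero (AddSubgroup.index_ne_zero_of_finite)

theorem idx_triangle (U V W : CompactOpenSubgroup G) : U.idx W ≤ U.idx V * V.idx W := by
  have hUV := (U.idx_pos V).ne'
  have hVW := (V.idx_pos W).ne'
  rw [idx_eq] at hUV hVW
  have h1 : (W.toAddSubgroup ⊓ V.toAddSubgroup).relIndex U.toAddSubgroup ≤ U.idx V * V.idx W := by
    rw [← AddSubgroup.relIndex_inf_mul_relIndex, idx_eq, idx_eq, mul_comm]
    exact Nat.mul_le_mul_left _ (AddSubgroup.relIndex_le_of_le_right inf_le_left hVW)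
  refine le_trans ?_ h1
  rw [idx_eq]
  refine AddSubgroup.relIndex_le_of_le_left inf_le_left ?_
  have hUW := (U.idx_pos W).ne'
  rw [idx_eq] at hUW
  exact AddSubgroup.relIndex_inf_ne_zero hUW hUV

/-- The metric `d(V, W) = log (|V : V ∩ W| * |W : W ∩ V|)` on `𝓑(G)`. -/
instance : MetricSpace (CompactOpenSubgroup G) where
  dist V W := Real.log ((V.idx W : ℝ) * (W.idx V : ℝ))
  dist_self V := by simp [idx_eq]
  dist_comm V W := by rw [mul_comm]
  dist_triangle U V W := by
    have hp : ∀ A B : CompactOpenSubgroup G, (0 : ℝ) < A.idx B :=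
      fun A B => Nat.cast_pos.mpr (A.idx_pos B)
    have h1 : (U.idx W : ℝ) ≤ U.idx V * V.idx W := mod_cast idx_triangle U V W
    have h2 : (W.idx U : ℝ) ≤ W.idx V * V.idx U := mod_cast idx_triangle W V U
    rw [← Real.log_mul (mul_pos (hp _ _) (hp _ _)).ne' (mul_pos (hp _ _) (hp _ _)).ne']
    refine Real.log_le_log (mul_pos (hp _ _) (hp _ _)) ?_
    calc (U.idx W : ℝ) * W.idx U
        ≤ (U.idx V * V.idx W) * (W.idx V * V.idx U) :=
          mul_le_mul h1 h2 (hp _ _).le (mul_pos (hp _ _) (hp _ _)).le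
      _ = _ := by ring
  eq_of_dist_eq_zero := by
    intro V W h
    have hV := V.idx_pos W
    have hW := W.idx_pos V
    have h' : Real.log ((V.idx W * W.idx V : ℕ) : ℝ) = 0 := by push_cast; exact h
    have h1 : V.idx W * W.idx V = 1 := by
      rcases Real.log_eq_zero.mp h' with h0 | h0 | h0
      · exact absurd (Nat.cast_eq_zero.mp h0) (Nat.mul_pos hV hW).ne'
      · exact_mod_cast h0
      · have : (0 : ℝ) ≤ ((V.idx W * W.idx V : ℕ) : ℝ) := Nat.cast_nonneg _
        linarith
    obtain ⟨ha, hb⟩ := mul_eq_one.mp h1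
    rw [idx_eq, AddSubgroup.relIndex_eq_one] at ha hb
    exact CompactOpenSubgroup.ext (le_antisymm ha hb)

end Metric

end CompactOpenSubgroup

/-- A group `H` of automorphisms of `G` is flat if some compact, open subgroup `O` minimizes the
displacement functions `V ↦ d(φ(V), V)` of all `φ ∈ H` simultaneously. -/
def IsFlat {G : Type*} [AddGroup G] [TopologicalSpace G] [IsTopologicalAddGroup G]
    (H : Subgroup (G ≃ₜ+ G)) : Prop :=
  ∃ O : CompactOpenSubgroup G, ∀ φ ∈ H, ∀ V : CompactOpenSubgroup G,
    dist (φ • O) O ≤ dist (φ • V) V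

/-- `f` is a quasi-isometry: a quasi-isometric embedding with coarsely dense image. -/
def IsQuasiIsometry {X Y : Type*} [MetricSpace X] [MetricSpace Y] (f : X → Y) : Prop :=
  ∃ L C : ℝ, 1 ≤ L ∧ 0 ≤ C ∧
    (∀ x x' : X, L⁻¹ * dist x x' - C ≤ dist (f x) (f x') ∧
      dist (f x) (f x') ≤ L * dist x x' + C) ∧
    ∀ y : Y, ∃ x : X, dist (f x) y ≤ C

/-- Two metric spaces are quasi-isometric. -/
def QuasiIsometric (X Y : Type*) [MetricSpace X] [MetricSpace Y] : Prop :=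
  ∃ f : X → Y, IsQuasiIsometry f

namespace PadicPlane

variable (p : ℕ) [Fact p.Prime]

/-- The linear action of an invertible matrix on column vectors, as a topological automorphism of
the additive group `ℚ_p²`. -/
def ofGL (A : GL (Fin 2) ℚ_[p]) : (Fin 2 → ℚ_[p]) ≃ₜ+ (Fin 2 → ℚ_[p]) where
  toFun v := (A : Matrix (Fin 2) (Fin 2) ℚ_[p]).mulVec v
  invFun v := ((A⁻¹ : GL (Fin 2) ℚ_[p]) : Matrix (Fin 2) (Fin 2) ℚ_[p]).mulVec v
  left_inv v := by beta_reduce; rw [Matrix.mulVec_mulVec, ← Units.val_mul, inv_mul_cancel]; simp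
  right_inv v := by beta_reduce; rw [Matrix.mulVec_mulVec, ← Units.val_mul, mul_inv_cancel]; simp
  map_add' v w := Matrix.mulVec_add _ v w
  continuous_toFun := Continuous.matrix_mulVec continuous_const continuous_id
  continuous_invFun := Continuous.matrix_mulVec continuous_const continuous_id

theorem p_ne_zero : (p : ℚ_[p]) ≠ 0 := Nat.cast_ne_zero.mpr (Fact.out : p.Prime).ne_zero

/-- `s₁`, the matrix with rows `(0, -1)` and `(1, 0)`. -/
def s₁ : (Fin 2 → ℚ_[p]) ≃ₜ+ (Fin 2 → ℚ_[p]) :=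
  ofGL p (Matrix.GeneralLinearGroup.mkOfDetNeZero !![0, -1; 1, 0] (by simp [Matrix.det_fin_two]))

/-- `s₂`, the matrix with rows `(0, -p⁻¹)` and `(p, 0)`. -/
def s₂ : (Fin 2 → ℚ_[p]) ≃ₜ+ (Fin 2 → ℚ_[p]) :=
  ofGL p (Matrix.GeneralLinearGroup.mkOfDetNeZero !![0, -(p : ℚ_[p])⁻¹; (p : ℚ_[p]), 0]
    (by simp [Matrix.det_fin_two, p_ne_zero p]))

/-- The group of automorphisms of `ℚ_p²` generated by `s₁` and `s₂`. -/
def H : Subgroup ((Fin 2 → ℚ_[p]) ≃ₜ+ (Fin 2 → ℚ_[p])) :=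
  Subgroup.closure {s₁ p, s₂ p}

theorem s₁_mem : s₁ p ∈ H p := Subgroup.subset_closure (by simp)

theorem s₂_mem : s₂ p ∈ H p := Subgroup.subset_closure (by simp)

end PadicPlane

end

/-! Properness: if `d(V, W) ≤ r`, both indices are at most `N = ⌈exp r⌉`, so multiplication by `N!`
carries each group into the other. Thus `W` lies between `N! V` and its preimage counterpart `(N!)⁻¹
V`, and `finite_Icc` makes the ball finite.

Structure: up to sign, each element of `H` is `diag(pⁿ, p⁻ⁿ)` or `s₁` times it. `IsMonomial` records
this as a relation with the infinite dihedral group that is multiplicative and single-valued, hence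
gives a homomorphism with kernel `{1, -1}`.

Orbits: the orbit of `box p 0 0` is the line of boxes `box p (-n) n`, whose distances are comparable
to `|m - n|` (`dist_box_bounds`). Since `H` acts by isometries, any other orbit stays within bounded
error of it.

Non-flatness: `s₁` and `s₂` each fix a box, so a common minimizer would be fixed by both, hence by
`H`, while orbits are unbounded. -/

namespace CompactOpenSubgroup

/-! ### Isometric action, finite intervals and properness. -/

section Basic

variable {G : Type*} [AddGroup G] [TopologicalSpace G]

theorem mem_smul (φ : G ≃ₜ+ G) (V : CompactOpenSubgroup G) (x : G) :
    x ∈ (φ • V).toAddSubgroup ↔ ∃ v ∈ V.toAddSubgroup, φ v = x :=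
  Iff.rfl

theorem mem_smul_iff (φ : G ≃ₜ+ G) (V : CompactOpenSubgroup G) (x : G) :
    x ∈ (φ • V).toAddSubgroup ↔ φ⁻¹ x ∈ V.toAddSubgroup := by
  rw [mem_smul]
  constructor
  · rintro ⟨v, hv, rfl⟩
    rwa [show φ⁻¹ (φ v) = v from φ.symm_apply_apply v]
  · exact fun h => ⟨_, h, φ.apply_symm_apply x⟩

theorem idx_smul (φ : G ≃ₜ+ G) (V W : CompactOpenSubgroup G) :
    (φ • V).idx (φ • W) = V.idx W := by
  rw [idx_eq, idx_eq]
  exact AddSubgroup.relIndex_map_map_of_injective _ _ φ.injective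

variable [IsTopologicalAddGroup G]

theorem dist_def (V W : CompactOpenSubgroup G) :
    dist V W = Real.log ((V.idx W : ℝ) * (W.idx V : ℝ)) :=
  rfl

/-- Topological automorphisms act on `𝓑(G)` by isometries. -/
theorem dist_smul_smul (φ : G ≃ₜ+ G) (V W : CompactOpenSubgroup G) :
    dist (φ • V) (φ • W) = dist V W := by
  simp only [dist_def, idx_smul]

theorem log_idx_le_dist (V W : CompactOpenSubgroup G) :
    Real.log (V.idx W) ≤ dist V W := by
  have h1 : (0 : ℝ) < V.idx W := Nat.cast_pos.mpr (V.idx_pos W)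
  have h2 : (1 : ℝ) ≤ W.idx V := Nat.one_le_cast.mpr (W.idx_pos V)
  rw [dist_def]
  exact Real.log_le_log h1 (le_mul_of_one_le_right h1.le h2)

theorem idx_le_of_dist_le {V W : CompactOpenSubgroup G} {r : ℝ} (h : dist V W ≤ r) :
    V.idx W ≤ ⌈Real.exp r⌉₊ := by
  have h1 : (0 : ℝ) < V.idx W := Nat.cast_pos.mpr (V.idx_pos W)
  have h2 := (Real.log_le_iff_le_exp h1).mp ((log_idx_le_dist V W).trans h)
  exact_mod_cast h2.trans (Nat.le_ceil _)

/-- Only finitely many compact open subgroups lie between two given ones. -/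
theorem finite_Icc (U T : CompactOpenSubgroup G) :
    {W : CompactOpenSubgroup G | U.toAddSubgroup ≤ W.toAddSubgroup ∧
      W.toAddSubgroup ≤ T.toAddSubgroup}.Finite := by
  have : CompactSpace T.toAddSubgroup := isCompact_iff_compactSpace.mp T.isCompact
  let U' := U.toAddSubgroup.addSubgroupOf T.toAddSubgroup
  have hfin : Finite (T.toAddSubgroup ⧸ U') := AddSubgroup.quotient_finite_of_isOpen
    (U.toAddSubgroup.addSubgroupOf T.toAddSubgroup)
    (U.isOpen.preimage continuous_subtype_val)
  -- A group between `U` and `T` is a union of cosets of `U`, so its image in the finite quotient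
  -- determines it.
  let F : CompactOpenSubgroup G → Set (T.toAddSubgroup ⧸ U') := fun W =>
    (QuotientAddGroup.mk : T.toAddSubgroup → T.toAddSubgroup ⧸ U') ''
      (W.toAddSubgroup.addSubgroupOf T.toAddSubgroup : Set T.toAddSubgroup)
  have key : ∀ W₁ W₂ : CompactOpenSubgroup G, W₁.toAddSubgroup ≤ T.toAddSubgroup →
      U.toAddSubgroup ≤ W₂.toAddSubgroup → F W₁ = F W₂ →
      W₁.toAddSubgroup ≤ W₂.toAddSubgroup := by
    intro W₁ W₂ h1 h2 h x hx
    have hm : (QuotientAddGroup.mk (⟨x, h1 hx⟩ : T.toAddSubgroup) : T.toAddSubgroup ⧸ U') ∈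
        F W₂ := h ▸ ⟨_, hx, rfl⟩
    obtain ⟨y, hy, hxy⟩ := hm
    have h3 : (-y + ⟨x, h1 hx⟩ : T.toAddSubgroup) ∈ U' := QuotientAddGroup.eq.mp hxy
    have h4 : -(y : G) + x ∈ W₂.toAddSubgroup := h2 h3
    have h5 := W₂.toAddSubgroup.add_mem hy h4
    simpa using h5
  refine Set.Finite.of_finite_image (f := F) (Set.toFinite _) ?_
  rintro W₁ ⟨h1, h1'⟩ W₂ ⟨h2, h2'⟩ h
  exact CompactOpenSubgroup.ext (le_antisymm (key _ _ h1' h2 h) (key _ _ h2' h1 h.symm))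

end Basic

/-- If multiplication by every positive integer is a topological automorphism of an abelian
group, then its space of compact open subgroups is proper. -/
theorem properSpace_of_nsmul {G : Type*} [AddCommGroup G] [TopologicalSpace G]
    [IsTopologicalAddGroup G] (h : ∀ n : ℕ, n ≠ 0 → ∃ φ : G ≃ₜ+ G, ∀ x, φ x = n • x) :
    ProperSpace (CompactOpenSubgroup G) := by
  refine ⟨fun V r => Set.Finite.isCompact ?_⟩
  -- The factorial is a common multiple of all indices that can occur within distance `r`.
  obtain ⟨φ, hφ⟩ := h (⌈Real.exp r⌉₊).factorial (Nat.factorial_ne_zero _)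
  have key : ∀ A B : CompactOpenSubgroup G, dist A B ≤ r → ∀ x ∈ A.toAddSubgroup,
      φ x ∈ B.toAddSubgroup := by
    intro A B hAB x hx
    obtain ⟨k, hk⟩ := Nat.dvd_factorial (A.idx_pos B) (idx_le_of_dist_le hAB)
    rw [hφ, hk, mul_comm, mul_smul, idx_eq]
    exact B.toAddSubgroup.nsmul_mem (AddSubgroup.nsmul_relIndex_mem B.toAddSubgroup hx) k
  refine (finite_Icc (φ • V) (φ⁻¹ • V)).subset fun W hW => ⟨?_, ?_⟩
  · rintro _ ⟨v, hv, rfl⟩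
    exact key V W (by rw [dist_comm]; exact hW) v hv
  · intro w hw
    exact (mem_smul _ _ _).mpr ⟨φ w, key W V hW w hw, φ.symm_apply_apply w⟩

end CompactOpenSubgroup

/-! ### Monomial matrices and the infinite dihedral quotient. -/

namespace PadicPlane

variable (p : ℕ) [Fact p.Prime]

theorem exists_nsmul_equiv (n : ℕ) (hn : n ≠ 0) :
    ∃ φ : (Fin 2 → ℚ_[p]) ≃ₜ+ (Fin 2 → ℚ_[p]), ∀ x, φ x = n • x := by
  have hn' : (n : ℚ_[p]) ≠ 0 := Nat.cast_ne_zero.mpr hn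
  refine ⟨ofGL p (Matrix.GeneralLinearGroup.mkOfDetNeZero !![(n : ℚ_[p]), 0; 0, (n : ℚ_[p])]
    (by simp [Matrix.det_fin_two, hn'])), fun x => ?_⟩
  change Matrix.mulVec !![(n : ℚ_[p]), 0; 0, (n : ℚ_[p])] x = n • x
  ext i
  fin_cases i <;> simp [Matrix.mulVec, dotProduct, Fin.sum_univ_two]

theorem s₁_apply (v : Fin 2 → ℚ_[p]) : s₁ p v = ![-v 1, v 0] := by
  change Matrix.mulVec !![0, -1; 1, 0] v = _
  ext i
  fin_cases i <;> simp [Matrix.mulVec, dotProduct, Fin.sum_univ_two]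

theorem s₂_apply (v : Fin 2 → ℚ_[p]) : s₂ p v = ![-((p : ℚ_[p])⁻¹ * v 1), p * v 0] := by
  change Matrix.mulVec !![0, -(p : ℚ_[p])⁻¹; (p : ℚ_[p]), 0] v = _
  ext i
  fin_cases i <;> simp [Matrix.mulVec, dotProduct, Fin.sum_univ_two]

/-- `φ` is, up to sign, the monomial matrix attached to an element of the infinite dihedral group:
`diag (pⁿ, p⁻ⁿ)` for the rotation `r n`, and `s₁ * diag (pⁿ, p⁻ⁿ)` for the reflection `sr n`. -/
def IsMonomial (φ : (Fin 2 → ℚ_[p]) ≃ₜ+ (Fin 2 → ℚ_[p])) : DihedralGroup 0 → Prop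
  | .r n => ∃ e : ℚ_[p], (e = 1 ∨ e = -1) ∧
      ∀ v, φ v = ![e * ((p : ℚ_[p]) ^ (id n : ℤ) * v 0), e * ((p : ℚ_[p]) ^ (-(id n : ℤ)) * v 1)]
  | .sr n => ∃ e : ℚ_[p], (e = 1 ∨ e = -1) ∧
      ∀ v, φ v =
        ![-(e * ((p : ℚ_[p]) ^ (-(id n : ℤ)) * v 1)), e * ((p : ℚ_[p]) ^ (id n : ℤ) * v 0)]

variable {p}

/-- `ZMod 0` is `ℤ` only by unfolding; this form exposes an integer exponent. -/
theorem isMonomial_r {φ : (Fin 2 → ℚ_[p]) ≃ₜ+ (Fin 2 → ℚ_[p])} {n : ℤ} :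
    IsMonomial p φ (.r n) ↔ ∃ e : ℚ_[p], (e = 1 ∨ e = -1) ∧
      ∀ v, φ v = ![e * ((p : ℚ_[p]) ^ n * v 0), e * ((p : ℚ_[p]) ^ (-n) * v 1)] :=
  Iff.rfl

theorem isMonomial_sr {φ : (Fin 2 → ℚ_[p]) ≃ₜ+ (Fin 2 → ℚ_[p])} {n : ℤ} :
    IsMonomial p φ (.sr n) ↔ ∃ e : ℚ_[p], (e = 1 ∨ e = -1) ∧
      ∀ v, φ v = ![-(e * ((p : ℚ_[p]) ^ (-n) * v 1)), e * ((p : ℚ_[p]) ^ n * v 0)] :=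
  Iff.rfl

theorem isMonomial_s₁ : IsMonomial p (s₁ p) (.sr 0) :=
  (isMonomial_sr (n := 0)).mpr ⟨1, .inl rfl, fun v => by simp [s₁_apply]⟩

theorem isMonomial_s₂ : IsMonomial p (s₂ p) (.sr 1) :=
  (isMonomial_sr (n := 1)).mpr ⟨1, .inl rfl, fun v => by simp [s₂_apply]⟩

theorem isMonomial_one : IsMonomial p 1 1 :=
  (isMonomial_r (n := 0)).mpr ⟨1, .inl rfl, fun v => by
    change v = _
    ext i
    fin_cases i <;> simp⟩

theorem sign_mul {e e' : ℚ_[p]} (h : e = 1 ∨ e = -1) (h' : e' = 1 ∨ e' = -1) :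
    e * e' = 1 ∨ e * e' = -1 := by
  rcases h with rfl | rfl <;> rcases h' with rfl | rfl <;> simp

theorem sign_neg {e : ℚ_[p]} (h : e = 1 ∨ e = -1) : -e = 1 ∨ -e = -1 := by
  rcases h with rfl | rfl <;> simp

theorem norm_sign {e : ℚ_[p]} (h : e = 1 ∨ e = -1) : ‖e‖ = 1 := by
  rcases h with rfl | rfl <;> simp

/-- Two reflections multiply with an extra sign because `s₁ ^ 2 = -1`; hence the sign `e` in
`IsMonomial`. -/
theorem IsMonomial.mul {φ ψ : (Fin 2 → ℚ_[p]) ≃ₜ+ (Fin 2 → ℚ_[p])} {x y : DihedralGroup 0}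
    (hx : IsMonomial p φ x) (hy : IsMonomial p ψ y) : IsMonomial p (φ * ψ) (x * y) := by
  have hp := p_ne_zero p
  have hmul : ∀ v, (φ * ψ) v = φ (ψ v) := fun _ => rfl
  rcases x with (m : ℤ) | (m : ℤ) <;> rcases y with (n : ℤ) | (n : ℤ) <;>
    obtain ⟨e, he, hφ⟩ := hx <;> obtain ⟨e', he', hψ⟩ := hy <;>
    simp only [id] at hφ hψ
  · refine (isMonomial_r (n := m + n)).mpr ⟨e * e', sign_mul he he', fun v => ?_⟩
    rw [hmul, hφ, hψ]
    ext i
    fin_cases i <;> simp [zpow_add₀ hp] <;> ring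
  · refine (isMonomial_sr (n := n - m)).mpr ⟨e * e', sign_mul he he', fun v => ?_⟩
    rw [hmul, hφ, hψ]
    ext i
    fin_cases i <;> simp [zpow_sub₀ hp] <;> ring
  · refine (isMonomial_sr (n := m + n)).mpr ⟨e * e', sign_mul he he', fun v => ?_⟩
    rw [hmul, hφ, hψ]
    ext i
    fin_cases i <;> simp [zpow_add₀ hp] <;> ring
  · refine (isMonomial_r (n := n - m)).mpr ⟨-(e * e'), sign_neg (sign_mul he he'), fun v => ?_⟩
    rw [hmul, hφ, hψ]
    ext i
    fin_cases i <;> simp [zpow_sub₀ hp] <;> ring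

/-- The image of the first basis vector has one nonzero entry: its position tells rotations from
reflections, and its norm gives the exponent whatever the sign. -/
theorem IsMonomial.eq {φ : (Fin 2 → ℚ_[p]) ≃ₜ+ (Fin 2 → ℚ_[p])} {x y : DihedralGroup 0}
    (hx : IsMonomial p φ x) (hy : IsMonomial p φ y) : x = y := by
  have h1 : (1 : ℝ) < p := mod_cast (Fact.out : p.Prime).one_lt
  have hinj : ∀ {m n : ℤ}, (p : ℝ) ^ m = (p : ℝ) ^ n → m = n := fun h =>
    zpow_right_injective₀ (by linarith) h1.ne' h
  rcases x with (m : ℤ) | (m : ℤ) <;> rcases y with (n : ℤ) | (n : ℤ) <;>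
    obtain ⟨e, he, hφ⟩ := hx <;> obtain ⟨e', he', hψ⟩ := hy <;>
    simp only [id] at hφ hψ <;>
    have h := (hφ ![1, 0]).symm.trans (hψ ![1, 0])
  · have h0 := congrArg norm (congrFun h 0)
    simp [norm_sign he, norm_sign he'] at h0
    exact congrArg _ (hinj h0)
  · have h0 := congrArg norm (congrFun h 0)
    simp [norm_sign he] at h0
    exact absurd h0 (zpow_ne_zero m (by linarith))
  · have h0 := congrArg norm (congrFun h 0)
    simp [norm_sign he'] at h0
    exact absurd h0.symm (zpow_ne_zero n (by linarith))
  · have h0 := congrArg norm (congrFun h 1)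
    simp [norm_sign he, norm_sign he'] at h0
    exact congrArg _ (hinj h0)

theorem isMonomial_one_iff {φ : (Fin 2 → ℚ_[p]) ≃ₜ+ (Fin 2 → ℚ_[p])} :
    IsMonomial p φ 1 ↔ φ = 1 ∨ ∀ v, φ v = -v := by
  constructor
  · intro hφ
    obtain ⟨e, rfl | rfl, h⟩ := (isMonomial_r (n := 0)).mp hφ
    · refine .inl (ContinuousAddEquiv.ext fun v => (h v).trans ?_)
      change _ = v
      ext i
      fin_cases i <;> simp
    · refine .inr fun v => (h v).trans ?_
      ext i
      fin_cases i <;> simp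
  · rintro (rfl | h)
    · exact isMonomial_one
    · refine (isMonomial_r (n := 0)).mpr ⟨-1, .inr rfl, fun v => (h v).trans ?_⟩
      ext i
      fin_cases i <;> simp

theorem IsMonomial.inv {φ : (Fin 2 → ℚ_[p]) ≃ₜ+ (Fin 2 → ℚ_[p])} {x : DihedralGroup 0}
    (hx : IsMonomial p φ x) : IsMonomial p φ⁻¹ x⁻¹ := by
  have hp := p_ne_zero p
  have hsymm : ∀ v w, v = φ w → φ⁻¹ v = w := by
    rintro _ w rfl
    exact φ.symm_apply_apply w
  have hsq : ∀ {e : ℚ_[p]}, e = 1 ∨ e = -1 → e * e = 1 := by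
    rintro e (rfl | rfl) <;> simp
  rcases x with (n : ℤ) | (n : ℤ) <;> obtain ⟨e, he, hφ⟩ := hx <;> simp only [id] at hφ
  · refine (isMonomial_r (n := -n)).mpr ⟨e, he, fun v => hsymm _ _ ?_⟩
    rw [hφ]
    ext i
    fin_cases i
    · simp
      field_simp
      linear_combination (-v 0) * hsq he
    · simp
      field_simp
      linear_combination (-v 1) * hsq he
  -- Here `φ ^ 2 = -1`, so the inverse is `-φ`.
  · refine (isMonomial_sr (n := n)).mpr ⟨-e, sign_neg he, fun v => hsymm _ _ ?_⟩
    rw [hφ]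
    ext i
    fin_cases i
    · simp
      field_simp
      linear_combination (-v 0) * hsq he
    · simp
      field_simp
      linear_combination (-v 1) * hsq he

theorem exists_isMonomial {φ : (Fin 2 → ℚ_[p]) ≃ₜ+ (Fin 2 → ℚ_[p])} (hφ : φ ∈ H p) :
    ∃ x, IsMonomial p φ x := by
  induction hφ using Subgroup.closure_induction with
  | mem s hs =>
    rcases hs with rfl | rfl
    exacts [⟨_, isMonomial_s₁⟩, ⟨_, isMonomial_s₂⟩]
  | one => exact ⟨_, isMonomial_one⟩
  | mul φ ψ _ _ h h' =>
    obtain ⟨x, hx⟩ := h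
    obtain ⟨y, hy⟩ := h'
    exact ⟨_, hx.mul hy⟩
  | inv φ _ h =>
    obtain ⟨x, hx⟩ := h
    exact ⟨_, hx.inv⟩

variable (p)

/-- The quotient map from `H` onto the infinite dihedral group. -/
noncomputable def toDihedral : H p →* DihedralGroup 0 where
  toFun h := (exists_isMonomial h.2).choose
  map_one' := (exists_isMonomial (H p).one_mem).choose_spec.eq isMonomial_one
  map_mul' g h := (exists_isMonomial (g * h).2).choose_spec.eq
    ((exists_isMonomial g.2).choose_spec.mul (exists_isMonomial h.2).choose_spec)

variable {p}

theorem isMonomial_toDihedral (h : H p) : IsMonomial p h.1 (toDihedral p h) :=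
  (exists_isMonomial h.2).choose_spec

theorem toDihedral_s₁ : toDihedral p ⟨s₁ p, s₁_mem p⟩ = .sr 0 :=
  (isMonomial_toDihedral _).eq isMonomial_s₁

theorem toDihedral_s₂ : toDihedral p ⟨s₂ p, s₂_mem p⟩ = .sr 1 :=
  (isMonomial_toDihedral _).eq isMonomial_s₂

theorem toDihedral_surjective : Function.Surjective (toDihedral p) := by
  have hr : ∀ n : ZMod 0, ∃ h, toDihedral p h = .r n := by
    intro n
    -- The product of the two reflections is the unit rotation `r 1`.
    refine ⟨(⟨s₁ p, s₁_mem p⟩ * ⟨s₂ p, s₂_mem p⟩) ^ (id n : ℤ), ?_⟩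
    rw [map_zpow, map_mul, toDihedral_s₁, toDihedral_s₂, DihedralGroup.sr_mul_sr, sub_zero,
      DihedralGroup.r_one_zpow]
    rfl
  rintro (n | n)
  · exact hr n
  · obtain ⟨h, hh⟩ := hr n
    exact ⟨⟨s₁ p, s₁_mem p⟩ * h, by
      rw [map_mul, toDihedral_s₁, hh, DihedralGroup.sr_mul_r, zero_add]⟩

theorem toDihedral_eq_one_iff (h : H p) :
    toDihedral p h = 1 ↔ h = 1 ∨ ∀ v : Fin 2 → ℚ_[p], h.1 v = -v := by
  have h1 : h = 1 ↔ h.1 = 1 := Subtype.ext_iff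
  rw [h1, ← isMonomial_one_iff]
  exact ⟨fun h' => h' ▸ isMonomial_toDihedral h, fun h' => (isMonomial_toDihedral h).eq h'⟩

/-! ### Boxes and the standard apartment. -/

variable (p)

/-- The compact open subgroup of vectors with `‖v 0‖ ≤ pᵃ` and `‖v 1‖ ≤ pᵇ`. -/
def box (a b : ℤ) : CompactOpenSubgroup (Fin 2 → ℚ_[p]) where
  toAddSubgroup :=
    { carrier := {v | ‖v 0‖ ≤ (p : ℝ) ^ a ∧ ‖v 1‖ ≤ (p : ℝ) ^ b}
      zero_mem' := by
        constructor <;> simp only [Pi.zero_apply, norm_zero] <;> positivity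
      add_mem' := fun hv hw =>
        ⟨(Padic.nonarchimedean _ _).trans (max_le hv.1 hw.1),
          (Padic.nonarchimedean _ _).trans (max_le hv.2 hw.2)⟩
      neg_mem' := fun hv => by simpa using hv }
  isCompact := by
    refine (isCompact_univ_pi fun i : Fin 2 =>
      isCompact_closedBall (0 : ℚ_[p]) ((p : ℝ) ^ (![a, b] i))).of_isClosed_subset ?_ ?_
    · have h : ∀ (c : ℤ) (i : Fin 2), IsClosed {v : Fin 2 → ℚ_[p] | ‖v i‖ ≤ (p : ℝ) ^ c} :=
        fun c i => isClosed_le (by fun_prop) continuous_const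
      exact (h a 0).inter (h b 1)
    · intro v hv i _
      fin_cases i
      · simpa using hv.1
      · simpa using hv.2
  isOpen := by
    have hp : (0 : ℝ) < p := mod_cast (Fact.out : p.Prime).pos
    have h : ∀ (c : ℤ) (i : Fin 2), IsOpen {v : Fin 2 → ℚ_[p] | ‖v i‖ ≤ (p : ℝ) ^ c} := by
      intro c i
      have h1 := (IsUltrametricDist.isOpen_closedBall (0 : ℚ_[p])
        (zpow_pos hp c).ne').preimage (continuous_apply (A := fun _ : Fin 2 => ℚ_[p]) i)
      convert h1 using 1
      ext v
      simp
    exact (h a 0).inter (h b 1)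

variable {p}

theorem mem_box {a b : ℤ} {v : Fin 2 → ℚ_[p]} :
    v ∈ (box p a b).toAddSubgroup ↔ ‖v 0‖ ≤ (p : ℝ) ^ a ∧ ‖v 1‖ ≤ (p : ℝ) ^ b :=
  Iff.rfl

theorem norm_sign_mul_zpow_mul_le_iff {e : ℚ_[p]} (he : e = 1 ∨ e = -1) (n a : ℤ) (x : ℚ_[p]) :
    ‖e * ((p : ℚ_[p]) ^ n * x)‖ ≤ (p : ℝ) ^ a ↔ ‖x‖ ≤ (p : ℝ) ^ (a + n) := by
  have hp : (0 : ℝ) < p := mod_cast (Fact.out : p.Prime).pos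
  rw [norm_mul, norm_mul, norm_sign he, one_mul, Padic.norm_p_zpow, zpow_neg, zpow_add₀ hp.ne',
    inv_mul_le_iff₀ (zpow_pos hp n), mul_comm]

theorem IsMonomial.smul_box_r {φ : (Fin 2 → ℚ_[p]) ≃ₜ+ (Fin 2 → ℚ_[p])} {n : ℤ}
    (h : IsMonomial p φ (.r n)) (a b : ℤ) : φ • box p a b = box p (a - n) (b + n) := by
  ext x
  obtain ⟨e, he, hφ⟩ := (isMonomial_r (n := -n)).mp h.inv
  rw [CompactOpenSubgroup.mem_smul_iff, mem_box, mem_box, hφ]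
  simp only [Matrix.cons_val_zero, Matrix.cons_val_one, norm_sign_mul_zpow_mul_le_iff he]
  rw [neg_neg, sub_eq_add_neg]

theorem IsMonomial.smul_box_sr {φ : (Fin 2 → ℚ_[p]) ≃ₜ+ (Fin 2 → ℚ_[p])} {n : ℤ}
    (h : IsMonomial p φ (.sr n)) (a b : ℤ) : φ • box p a b = box p (b + n) (a - n) := by
  ext x
  obtain ⟨e, he, hφ⟩ := (isMonomial_sr (n := n)).mp h.inv
  rw [CompactOpenSubgroup.mem_smul_iff, mem_box, mem_box, hφ]
  simp only [Matrix.cons_val_zero, Matrix.cons_val_one, norm_neg,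
    norm_sign_mul_zpow_mul_le_iff he]
  rw [and_comm, sub_eq_add_neg]

/-- The position on the standard apartment to which an element moves the base point. -/
def shift : DihedralGroup 0 → ℤ
  | .r n => id n
  | .sr n => -id n

theorem IsMonomial.smul_box_zero {φ : (Fin 2 → ℚ_[p]) ≃ₜ+ (Fin 2 → ℚ_[p])} {x : DihedralGroup 0}
    (h : IsMonomial p φ x) : φ • box p 0 0 = box p (-shift x) (shift x) := by
  rcases x with (n : ℤ) | (n : ℤ)
  · simpa [shift] using h.smul_box_r 0 0
  · have hs : shift (.sr n) = -n := rfl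
    rw [hs, neg_neg, h.smul_box_sr, zero_add, zero_sub]

theorem exists_toDihedral_eq_r (n : ℤ) : ∃ h : H p, toDihedral p h = .r n :=
  toDihedral_surjective _

/-- An element of `H` over `r m` translates the line of boxes by `m`, isometrically. -/
theorem dist_box_add (m k : ℤ) :
    dist (box p (-m) m) (box p (-(m + k)) (m + k)) = dist (box p 0 0) (box p (-k) k) := by
  obtain ⟨h, hh⟩ := exists_toDihedral_eq_r (p := p) m
  have hm : IsMonomial p h.1 (.r m) := hh ▸ isMonomial_toDihedral h
  rw [← CompactOpenSubgroup.dist_smul_smul h.1 (box p 0 0), hm.smul_box_r, hm.smul_box_r]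
  congr 2 <;> ring

theorem dist_box_natCast_le (k : ℕ) :
    dist (box p 0 0) (box p (-k) k) ≤ k * dist (box p 0 0) (box p (-1) 1) := by
  induction k with
  | zero => simp
  | succ k ih =>
    have h := dist_triangle (box p 0 0) (box p (-k) k) (box p (-(k + 1)) (k + 1))
    rw [dist_box_add] at h
    push_cast
    linarith

/-- Each inclusion in the chain of boxes `box p (-k) 0` is proper, so each step contributes a factor
of at least 2. -/
theorem two_pow_le_idx_box (k : ℕ) : 2 ^ k ≤ (box p 0 0).idx (box p (-k) 0) := by
  induction k with
  | zero => exact (box p 0 0).idx_pos _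
  | succ k ih =>
    have hp : (1 : ℝ) < p := mod_cast (Fact.out : p.Prime).one_lt
    have h1 : (box p (-(k + 1 : ℕ)) 0).toAddSubgroup ≤ (box p (-k) 0).toAddSubgroup :=
      fun v hv => ⟨hv.1.trans (zpow_le_zpow_right₀ hp.le (by push_cast; linarith)), hv.2⟩
    have h2 : (box p (-k) 0).toAddSubgroup ≤ (box p 0 0).toAddSubgroup :=
      fun v hv => ⟨hv.1.trans (zpow_le_zpow_right₀ hp.le (by simp)), hv.2⟩
    have h3 : 2 ≤ (box p (-k) 0).idx (box p (-(k + 1 : ℕ)) 0) := by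
      have hpos := (box p (-k) 0).idx_pos (box p (-(k + 1 : ℕ)) 0)
      have hne : (box p (-k) 0).idx (box p (-(k + 1 : ℕ)) 0) ≠ 1 := by
        rw [CompactOpenSubgroup.idx_eq, Ne, AddSubgroup.relIndex_eq_one]
        intro hle
        -- This vector has norm exactly `p⁻ᵏ`, so the next box misses it.
        have hmem : ![(p : ℚ_[p]) ^ (k : ℤ), 0] ∈ (box p (-k) 0).toAddSubgroup := by
          rw [mem_box]
          simp only [Matrix.cons_val_zero, Matrix.cons_val_one, Padic.norm_p_zpow, norm_zero]
          exact ⟨le_rfl, by positivity⟩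
        have h := (mem_box.mp (hle hmem)).1
        simp only [Matrix.cons_val_zero, Padic.norm_p_zpow] at h
        rw [zpow_le_zpow_iff_right₀ hp] at h
        push_cast at h
        linarith
      omega
    rw [CompactOpenSubgroup.idx_eq] at h3 ih ⊢
    rw [← AddSubgroup.relIndex_mul_relIndex _ _ _ h1 h2, pow_succ, mul_comm]
    exact Nat.mul_le_mul h3 ih

theorem natCast_mul_log_two_le_dist_box (k : ℕ) :
    k * Real.log 2 ≤ dist (box p 0 0) (box p (-k) k) := by
  -- Inside `box p 0 0` the bound `pᵏ` on the second coordinate is vacuous.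
  have h1 : (box p 0 0).idx (box p (-k) 0) = (box p 0 0).idx (box p (-k) k) := by
    have hp : (1 : ℝ) < p := mod_cast (Fact.out : p.Prime).one_lt
    have h : (box p 0 0).toAddSubgroup ⊓ (box p (-k) 0).toAddSubgroup =
        (box p 0 0).toAddSubgroup ⊓ (box p (-k) k).toAddSubgroup := by
      ext v
      simp only [AddSubgroup.mem_inf, mem_box]
      constructor
      · exact fun hv => ⟨hv.1, hv.2.1, hv.1.2.trans (zpow_le_zpow_right₀ hp.le (by simp))⟩
      · exact fun hv => ⟨hv.1, hv.2.1, hv.1.2⟩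
    rw [CompactOpenSubgroup.idx, CompactOpenSubgroup.idx, h]
  refine le_trans ?_ (CompactOpenSubgroup.log_idx_le_dist _ _)
  rw [← Real.log_pow, ← h1]
  exact Real.log_le_log (by positivity) (mod_cast two_pow_le_idx_box k)

/-- The standard apartment is quasi-isometrically embedded. -/
theorem dist_box_bounds (m n : ℤ) :
    |(m : ℝ) - n| * Real.log 2 ≤ dist (box p (-m) m) (box p (-n) n) ∧
      dist (box p (-m) m) (box p (-n) n) ≤
        |(m : ℝ) - n| * dist (box p 0 0) (box p (-1) 1) := by
  wlog hmn : m ≤ n generalizing m n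
  · rw [abs_sub_comm, dist_comm]
    exact this n m (by omega)
  obtain ⟨k, rfl⟩ := Int.le.dest hmn
  rw [dist_box_add, show |(m : ℝ) - ((m + k : ℤ) : ℝ)| = k by simp]
  exact ⟨natCast_mul_log_two_le_dist_box k, dist_box_natCast_le k⟩

/-! ### Orbits and the failure of flatness. -/

theorem abs_dist_smul_sub_le (g h : H p) (V : CompactOpenSubgroup (Fin 2 → ℚ_[p])) :
    |dist (g • V) (h • V) - dist (box p (-shift (toDihedral p g)) (shift (toDihedral p g)))
      (box p (-shift (toDihedral p h)) (shift (toDihedral p h)))| ≤ 2 * dist V (box p 0 0) := by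
  rw [← (isMonomial_toDihedral g).smul_box_zero, ← (isMonomial_toDihedral h).smul_box_zero]
  have hg := CompactOpenSubgroup.dist_smul_smul g.1 V (box p 0 0)
  have hh := CompactOpenSubgroup.dist_smul_smul h.1 V (box p 0 0)
  -- Replacing `V` by the base box costs `dist V (box p 0 0)` at each end.
  have h1 := dist_triangle4 (g.1 • V) (g.1 • box p 0 0) (h.1 • box p 0 0) (h.1 • V)
  have h2 := dist_triangle4 (g.1 • box p 0 0) (g.1 • V) (h.1 • V) (h.1 • box p 0 0)
  rw [dist_comm (h.1 • box p 0 0)] at h1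
  rw [dist_comm (g.1 • box p 0 0) (g.1 • V)] at h2
  change |dist (g.1 • V) (h.1 • V) - _| ≤ _
  rw [abs_le]
  constructor <;> linarith

theorem orbit_quasiIsometric_real (V : CompactOpenSubgroup (Fin 2 → ℚ_[p])) :
    QuasiIsometric (MulAction.orbit (H p) V) ℝ := by
  choose g hg using fun W : MulAction.orbit (H p) V => W.2
  simp only at hg
  set D := dist V (box p 0 0) with hD
  set q := dist (box p 0 0) (box p (-1) 1) with hq
  set l := Real.log 2 with hl
  have hl0 : 0 < l := Real.log_pos (by norm_num)
  have hD0 : 0 ≤ D := dist_nonneg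
  have hq0 : 0 ≤ q := dist_nonneg
  have key : ∀ (g h : H p),
      |(shift (toDihedral p g) : ℝ) - shift (toDihedral p h)| * l ≤
        dist (g • V) (h • V) + 2 * D ∧
      dist (g • V) (h • V) ≤
        |(shift (toDihedral p g) : ℝ) - shift (toDihedral p h)| * q + 2 * D := by
    intro g h
    have h1 := abs_le.mp (abs_dist_smul_sub_le g h V)
    have h2 := dist_box_bounds (p := p) (shift (toDihedral p g)) (shift (toDihedral p h))
    constructor <;> linarith
  have hL : (1 : ℝ) ≤ 1 + q + l⁻¹ := by
    have := inv_pos.mpr hl0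
    linarith
  set L : ℝ := 1 + q + l⁻¹ with hLdef
  have hLl : l⁻¹ ≤ L := by linarith
  have hLq : q ≤ L := by
    have := inv_pos.mpr hl0
    linarith
  have hdiv : ∀ {x y : ℝ}, 0 ≤ y → x * l ≤ y → x ≤ L * y := by
    intro x y hy hxy
    calc x = l⁻¹ * (x * l) := by field_simp
      _ ≤ l⁻¹ * y := by gcongr
      _ ≤ L * y := by gcongr
  have hLD : 2 * D ≤ L * (2 * D) := le_mul_of_one_le_left (by positivity) hL
  -- The term `L * (2 * D)` absorbs the change of base point and the choice of `g W`; the `1` pays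
  -- for rounding `y` down.
  refine ⟨fun W => (shift (toDihedral p (g W)) : ℝ), L, L * (2 * D) + 1, hL, by positivity, ?_, ?_⟩
  · intro W W'
    have hd : dist W W' = dist (g W • V) (g W' • V) := by
      rw [hg, hg]
      rfl
    obtain ⟨h1, h2⟩ := key (g W) (g W')
    rw [← hd] at h1 h2
    rw [Real.dist_eq]
    constructor
    · have h3 : dist W W' ≤
          L * |(shift (toDihedral p (g W)) : ℝ) - shift (toDihedral p (g W'))| + 2 * D := by
        refine h2.trans ?_
        rw [mul_comm]
        gcongr
      have hinv : L⁻¹ ≤ 1 := inv_le_one_of_one_le₀ hL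
      have h4 : L⁻¹ * dist W W' ≤
          |(shift (toDihedral p (g W)) : ℝ) - shift (toDihedral p (g W'))| + L⁻¹ * (2 * D) := by
        calc L⁻¹ * dist W W' ≤ L⁻¹ * (L * _ + 2 * D) := by gcongr
          _ = _ := by field_simp
      have h5 : L⁻¹ * (2 * D) ≤ 1 * (2 * D) := by gcongr
      linarith
    · have h3 := hdiv (by positivity) h1
      linarith
  · intro y
    obtain ⟨h, hh⟩ := exists_toDihedral_eq_r (p := p) ⌊y⌋
    refine ⟨⟨h • V, h, rfl⟩, ?_⟩
    -- The chosen representative may differ from `h`, but both carry `V` to the same point, so their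
    -- shifts are close.
    have h1 := (key (g ⟨h • V, h, rfl⟩) h).1
    rw [hg, dist_self, zero_add, hh] at h1
    have h2 := hdiv (by positivity) h1
    have h3 : (shift (.r ⌊y⌋) : ℤ) = ⌊y⌋ := rfl
    rw [h3] at h2
    have h4 : |(⌊y⌋ : ℝ) - y| ≤ 1 := by
      rw [abs_le]
      constructor <;> linarith [Int.floor_le y, Int.lt_floor_add_one y]
    rw [Real.dist_eq]
    exact (abs_sub_le _ (⌊y⌋ : ℝ) _).trans (add_le_add h2 h4)

theorem not_isFlat : ¬ IsFlat (H p) := by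
  rintro ⟨V, hV⟩
  -- A fixed point of `φ` makes its minimal displacement zero.
  have hfix : ∀ φ ∈ H p, ∀ W : CompactOpenSubgroup (Fin 2 → ℚ_[p]), φ • W = W → φ • V = V := by
    intro φ hφ W hW
    have h := hV φ hφ W
    rw [hW, dist_self] at h
    exact dist_le_zero.mp h
  have h1 : s₁ p • V = V := hfix _ (s₁_mem p) (box p 0 0)
    (by simpa using (isMonomial_s₁ (p := p)).smul_box_sr (n := 0) 0 0)
  have h2 : s₂ p • V = V := hfix _ (s₂_mem p) (box p 0 (-1))
    (by simpa using (isMonomial_s₂ (p := p)).smul_box_sr (n := 1) 0 (-1))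
  have hstab : H p ≤ MulAction.stabilizer _ V := by
    rw [H, Subgroup.closure_le]
    rintro _ (rfl | rfl)
    exacts [h1, h2]
  -- Translation by this `k` moves the base box too far for `V` to stay fixed.
  obtain ⟨k, hk⟩ := exists_nat_gt (2 * dist V (box p 0 0) / Real.log 2)
  rw [div_lt_iff₀ (Real.log_pos (by norm_num))] at hk
  obtain ⟨h, hh⟩ := exists_toDihedral_eq_r (p := p) k
  have h3 := abs_le.mp (abs_dist_smul_sub_le 1 h V)
  have h4 : h • V = V := hstab h.2
  have h5 : shift (.r (k : ℤ)) = k := rfl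
  have h6 : shift 1 = 0 := rfl
  rw [h4, one_smul, dist_self, map_one, hh, h5, h6] at h3
  have h7 := natCast_mul_log_two_le_dist_box (p := p) k
  rw [neg_zero] at h3
  linarith [h3.1]

theorem exists_neg_mem : ∃ h : H p, ∀ v : Fin 2 → ℚ_[p], h.1 v = -v := by
  refine ⟨⟨s₁ p * s₁ p, mul_mem (s₁_mem p) (s₁_mem p)⟩, fun v => ?_⟩
  change s₁ p (s₁ p v) = -v
  rw [s₁_apply, s₁_apply]
  ext i
  fin_cases i <;> simp

end PadicPlane

/-- For every prime `p`, with `G = ℚ_p²` and `H = ⟨s₁, s₂⟩`: the space `𝓑(G)` is proper; `H` is,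
modulo its central subgroup `{1, -1}`, the infinite dihedral group with the images of `s₁` and `s₂`
as canonical generating reflections; every `H`-orbit in `𝓑(G)` is quasi-isometric to `ℝ`; and `H`
is not flat. -/
theorem mainTheorem9 (p : ℕ) [Fact p.Prime] :
    ProperSpace (CompactOpenSubgroup (Fin 2 → ℚ_[p])) ∧
    (∃ h : PadicPlane.H p, ∀ v : Fin 2 → ℚ_[p], h.1 v = -v) ∧
    (∃ f : PadicPlane.H p →* DihedralGroup 0,
      Function.Surjective f ∧
      f ⟨PadicPlane.s₁ p, PadicPlane.s₁_mem p⟩ = DihedralGroup.sr 0 ∧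
      f ⟨PadicPlane.s₂ p, PadicPlane.s₂_mem p⟩ = DihedralGroup.sr 1 ∧
      ∀ h : PadicPlane.H p, f h = 1 ↔ (h = 1 ∨ ∀ v : Fin 2 → ℚ_[p], h.1 v = -v)) ∧
    (∀ V : CompactOpenSubgroup (Fin 2 → ℚ_[p]),
      QuasiIsometric (MulAction.orbit (PadicPlane.H p) V) ℝ) ∧
    ¬ IsFlat (PadicPlane.H p) := by
  exact ⟨CompactOpenSubgroup.properSpace_of_nsmul (PadicPlane.exists_nsmul_equiv p),
    PadicPlane.exists_neg_mem,
    ⟨PadicPlane.toDihedral p, PadicPlane.toDihedral_surjective, PadicPlane.toDihedral_s₁,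
      PadicPlane.toDihedral_s₂, PadicPlane.toDihedral_eq_one_iff⟩,
    PadicPlane.orbit_quasiIsometric_real, PadicPlane.not_isFlat⟩
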